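/- Let $G$ be a locally compact (Hausdorff) group, $H$ a compact subgroup with Haar probability measure $dh$, and $M(G/H)$ the space of regular countably additive complex Borel measures on the left coset space $G/H$. For $\lambda,\lambda'\in M(G/H)$, the convolution $\lambda*_{G/H}\lambda'\in M(G/H)$ and the involution $\lambda^{*^{G/H}}\in M(G/H)$ are the measures determined by $$\int_{G/H}\psi\,d(\lambda*_{G/H}\lambda')=\int_{G/H}\int_{G/H}\Big(\int_H\psi(xhyH)\,dh\Big)\,d\lambda(xH)\,d\lambda'(yH),$$ $$\int_{G/H}\psi\,d\lambda^{*^{G/H}}=\int_{G/H}\Big(\int_H\psi(h^{-1}x^{-1}H)\,dh\Big)\,d\overline{\lambda}(xH)$$ for all $\psi\in\mathcal C_0(G/H)$, where $\overline{\lambda}(E)=\overline{\lambda(E)}$. Then for all $\lambda,\lambda'\in M(G/H)$ these measures exist and are unique, and $$(\lambda*_{G/H}\lambda')^{*^{G/H}}=\lambda'^{*^{G/H}}*_{G/H}\lambda^{*^{G/H}}.$$ -/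

import Mathlib

open MeasureTheory
open scoped ZeroAtInfty

noncomputable section

/-- `M(X)`: the regular (countably additive) complex Borel measures on `X`; regularity of `lam` means
that its total variation measure `|lam|` is regular. -/
structure RegularComplexMeasure (X : Type*) [TopologicalSpace X] [MeasurableSpace X]
    [BorelSpace X] where
  toComplexMeasure : ComplexMeasure X
  regular : toComplexMeasure.variation.Regular

namespace ComplexCoset

/-- `∫ f dν`, the integral of a complex function against a complex measure. -/
def cintegral {X : Type*} [MeasurableSpace X] (ν : ComplexMeasure X) (f : X → ℂ) : ℂ :=
  ν.integral f (ContinuousLinearMap.mul ℝ ℂ)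

/-- The complex conjugate measure `E ↦ conj (ν E)`. -/
def conjMeasure {X : Type*} [MeasurableSpace X] (ν : ComplexMeasure X) : ComplexMeasure X :=
  ν.mapRange (starRingEnd ℂ).toAddMonoidHom Complex.continuous_conj

instance {X : Type*} [TopologicalSpace X] [MeasurableSpace X] [BorelSpace X] :
    Inhabited (RegularComplexMeasure X) :=
  ⟨⟨0, by simp only [VectorMeasure.variation_zero]; exact Measure.Regular.zero⟩⟩

section Coset

variable {G : Type*} [Group G] [TopologicalSpace G] [IsTopologicalGroup G]
  [MeasurableSpace G] [BorelSpace G] (H : Subgroup G) [CompactSpace H]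

/-- The Haar probability measure of the compact group `H`. -/
def haarProb : Measure H := Measure.haarMeasure (⊤ : TopologicalSpace.PositiveCompacts H)

instance : (haarProb H).IsMulLeftInvariant := by unfold haarProb; infer_instance

/-- The function `(xH, yH) ↦ ∫_H ψ(x h y H) dh` on `G/H × G/H`. -/
def convKernel (ψ : G ⧸ H → ℂ) (x y : G ⧸ H) : ℂ :=
  Quotient.liftOn' x (fun g : G => ∫ h : H, ψ ((g * (h : G)) • y) ∂(haarProb H)) (by
    intro a b hab
    have hab' : a⁻¹ * b ∈ H := QuotientGroup.leftRel_apply.mp hab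
    have key := integral_mul_left_eq_self (μ := haarProb H)
      (fun h : H => ψ ((a * (h : G)) • y)) (⟨a⁻¹ * b, hab'⟩ : H)
    simp only [Subgroup.coe_mul, mul_assoc, mul_inv_cancel_left] at key
    exact key.symm)

/-- The function `xH ↦ ∫_H ψ(h⁻¹ x⁻¹ H) dh` on `G/H`. -/
def invKernel (ψ : G ⧸ H → ℂ) (x : G ⧸ H) : ℂ :=
  Quotient.liftOn' x
    (fun g : G => ∫ h : H, ψ (((h : G)⁻¹ * g⁻¹ : G) : G ⧸ H) ∂(haarProb H)) (by
    intro a b hab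
    have hab' : a⁻¹ * b ∈ H := QuotientGroup.leftRel_apply.mp hab
    have key := integral_mul_left_eq_self (μ := haarProb H)
      (fun h : H => ψ (((h : G)⁻¹ * a⁻¹ : G) : G ⧸ H)) (⟨a⁻¹ * b, hab'⟩ : H)
    simp only [Subgroup.coe_mul, mul_inv_rev, inv_inv, mul_assoc, mul_inv_cancel, mul_one] at key
    exact key.symm)

variable {H} [MeasurableSpace (G ⧸ H)] [BorelSpace (G ⧸ H)]

/-- `κ` represents the functional
`ψ ↦ ∫_{G/H} ∫_{G/H} (∫_H ψ(x h y H) dh) dlam(xH) dlam'(yH)` on `C₀(G/H)`. -/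
def IsConv (lam lam' κ : RegularComplexMeasure (G ⧸ H)) : Prop :=
  ∀ ψ : C₀(G ⧸ H, ℂ), cintegral κ.toComplexMeasure ψ =
    cintegral lam'.toComplexMeasure
      (fun y => cintegral lam.toComplexMeasure (fun x => convKernel H ψ x y))

/-- `κ` represents the functional
`ψ ↦ ∫_{G/H} (∫_H ψ(h⁻¹ x⁻¹ H) dh) d(conj lam)(xH)` on `C₀(G/H)`. -/
def IsInvol (lam κ : RegularComplexMeasure (G ⧸ H)) : Prop :=
  ∀ ψ : C₀(G ⧸ H, ℂ), cintegral κ.toComplexMeasure ψ =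
    cintegral (conjMeasure lam.toComplexMeasure) (invKernel H ψ)

/-- The convolution `lam *_{G/H} lam'`: the measure `κ` with `IsConv lam lam' κ`. -/
def conv (lam lam' : RegularComplexMeasure (G ⧸ H)) : RegularComplexMeasure (G ⧸ H) :=
  Classical.epsilon (IsConv lam lam')

/-- The involution `lam^{*_{G/H}}`: the measure `κ` with `IsInvol lam κ`. -/
def invol (lam : RegularComplexMeasure (G ⧸ H)) : RegularComplexMeasure (G ⧸ H) :=
  Classical.epsilon (IsInvol lam)

end Coset

end ComplexCoset

end

noncomputable section

open Filter Topology Set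
open scoped ENNReal CompactlySupported Pointwise

section Regularity

variable {X : Type*} [TopologicalSpace X] [T2Space X] [MeasurableSpace X] [BorelSpace X]

theorem regular_of_forall_exists_isCompact {μ : Measure X} [IsFiniteMeasure μ]
    (h : ∀ A, MeasurableSet A → ∀ ε : ℝ≥0∞, ε ≠ 0 → ∃ K ⊆ A, IsCompact K ∧ μ (A \ K) < ε) :
    μ.Regular where
  outerRegular := by
    intro A hA r hr
    have hε : r - μ A ≠ 0 := (tsub_pos_of_lt hr).ne'
    obtain ⟨K, hKA, hK, hlt⟩ := h Aᶜ hA.compl _ hε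
    refine ⟨Kᶜ, subset_compl_comm.mp hKA, hK.isClosed.isOpen_compl, ?_⟩
    have hsub : Kᶜ ⊆ A ∪ (Aᶜ \ K) := by
      intro x hx
      by_cases hxA : x ∈ A
      · exact Or.inl hxA
      · exact Or.inr ⟨hxA, hx⟩
    calc μ Kᶜ ≤ μ A + μ (Aᶜ \ K) := (measure_mono hsub).trans (measure_union_le _ _)
      _ < μ A + (r - μ A) := ENNReal.add_lt_add_left (measure_ne_top _ _) hlt
      _ = r := add_tsub_cancel_of_le hr.le
  lt_top_of_isCompact K _ := measure_lt_top μ K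
  innerRegular := by
    intro U hU r hr
    have hε : μ U - r ≠ 0 := (tsub_pos_of_lt hr).ne'
    obtain ⟨K, hKU, hK, hlt⟩ := h U hU.measurableSet _ hε
    refine ⟨K, hKU, hK, ?_⟩
    by_contra! hle
    have h1 : μ U ≤ μ K + μ (U \ K) := by
      refine (measure_mono ?_).trans (measure_union_le _ _)
      rw [union_sdiff_cancel hKU]
    have h2 : μ U < r + (μ U - r) :=
      h1.trans_lt ((add_le_add_left hle _).trans_lt
        (ENNReal.add_lt_add_left (hr.trans_le le_top).ne hlt))
    rw [add_tsub_cancel_of_le hr.le] at h2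
    exact lt_irrefl _ h2

theorem regular_of_le {μ m : Measure X} [IsFiniteMeasure m] [m.Regular] (h : μ ≤ m) :
    μ.Regular := by
  have := isFiniteMeasure_of_le m h
  refine regular_of_forall_exists_isCompact fun A hA ε hε => ?_
  obtain ⟨K, hKA, hK, hlt⟩ := hA.exists_isCompact_sdiff_lt (measure_ne_top m A) hε
  exact ⟨K, hKA, hK, (h _).trans_lt hlt⟩

theorem regular_add {μ ν : Measure X} [IsFiniteMeasure μ] [IsFiniteMeasure ν] [μ.Regular]
    [ν.Regular] : (μ + ν).Regular := by
  refine regular_of_forall_exists_isCompact fun A hA ε hε => ?_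
  have hε2 : ε / 2 ≠ 0 := (ENNReal.half_pos hε).ne'
  obtain ⟨K, hKA, hK, hlt⟩ := hA.exists_isCompact_sdiff_lt (measure_ne_top μ A) hε2
  obtain ⟨L, hLA, hL, hlt'⟩ := hA.exists_isCompact_sdiff_lt (measure_ne_top ν A) hε2
  refine ⟨K ∪ L, union_subset hKA hLA, hK.union hL, ?_⟩
  rw [Measure.add_apply, ← ENNReal.add_halves ε]
  exact ENNReal.add_lt_add
    ((measure_mono (sdiff_subset_sdiff_right subset_union_left)).trans_lt hlt)
    ((measure_mono (sdiff_subset_sdiff_right subset_union_right)).trans_lt hlt')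

theorem regular_finsetSum {ι : Type*} (s : Finset ι) {μ : ι → Measure X}
    [∀ i, IsFiniteMeasure (μ i)] [∀ i, (μ i).Regular] : (∑ i ∈ s, μ i).Regular := by
  classical
  induction s using Finset.induction_on with
  | empty => simpa using Measure.Regular.zero
  | insert a s ha ih =>
    rw [Finset.sum_insert ha]
    exact regular_add

end Regularity

namespace ComplexCoset

section ComplexMeasures

variable {X : Type*} [MeasurableSpace X]

/-- A finite positive measure, viewed as a complex measure. -/
def ofMeasure (μ : Measure X) [IsFiniteMeasure μ] : ComplexMeasure X :=
  SignedMeasure.toComplexMeasure μ.toSignedMeasure 0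

theorem ofMeasure_apply (μ : Measure X) [IsFiniteMeasure μ] {s : Set X} (hs : MeasurableSet s) :
    ofMeasure μ s = (μ.real s : ℂ) := by
  apply Complex.ext <;>
    simp [ofMeasure, SignedMeasure.toComplexMeasure_apply, Measure.toSignedMeasure_apply, hs]

theorem variation_ofMeasure_le (μ : Measure X) [IsFiniteMeasure μ] :
    (ofMeasure μ).variation ≤ μ := by
  refine VectorMeasure.variation_le_of_forall_enorm_le fun E hE => ?_
  rw [ofMeasure_apply μ hE, ← ofReal_norm]
  simp [measureReal_def]

theorem variation_smul_ofMeasure_le (c : ℂ) (μ : Measure X) [IsFiniteMeasure μ] :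
    (c • ofMeasure μ).variation ≤ ‖c‖ₑ • μ := by
  rw [VectorMeasure.variation_smul]
  exact Measure.le_iff.2 fun s _ => by
    simp only [Measure.smul_apply, smul_eq_mul]
    exact mul_le_mul_right (variation_ofMeasure_le μ s) _

theorem integrable_smul_ofMeasure (c : ℂ) {μ : Measure X} [IsFiniteMeasure μ] {f : X → ℂ}
    (hf : Integrable f μ) : (c • ofMeasure μ).Integrable f :=
  hf.of_measure_le_smul enorm_ne_top (variation_smul_ofMeasure_le c μ)

theorem cintegral_smul_ofMeasure (c : ℂ) (μ : Measure X) [IsFiniteMeasure μ] {f : X → ℂ}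
    (hf : Integrable f μ) : cintegral (c • ofMeasure μ) f = c * ∫ x, f x ∂μ := by
  have hfin : IsFiniteMeasure (c • ofMeasure μ).variation := by
    have := variation_smul_ofMeasure_le c μ
    have : IsFiniteMeasure (‖c‖ₑ • μ) := ⟨by
      simpa using ENNReal.mul_lt_top enorm_lt_top (measure_lt_top μ univ)⟩
    exact isFiniteMeasure_of_le _ ‹_›
  have hcont : Continuous fun f : X →₁[μ] ℂ => cintegral (c • ofMeasure μ) f := by
    have key : ∀ f : X →₁[μ] ℂ, cintegral (c • ofMeasure μ) f =
        setToFun μ ((c • ofMeasure μ).transpose (ContinuousLinearMap.mul ℝ ℂ))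
          ((dominatedFinMeasAdditive_cbmApplyMeasure (c • ofMeasure μ)
            (ContinuousLinearMap.mul ℝ ℂ)).of_measure_le_smul enorm_ne_top
            (variation_smul_ofMeasure_le c μ) (ContinuousLinearMap.opNorm_nonneg _)) f := fun f =>
      (setToFun_congr_measure_of_integrable _ enorm_ne_top (variation_smul_ofMeasure_le c μ) _ _ _
        (L1.integrable_coeFn f)).symm
    simp only [key]
    exact continuous_setToFun _
  refine Integrable.induction (P := fun f => cintegral (c • ofMeasure μ) f = c * ∫ x, f x ∂μ)
    ?_ ?_ ?_ ?_ hf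
  · intro a s hs _
    rw [cintegral, VectorMeasure.integral_indicator_const _ hs, integral_indicator_const _ hs]
    simp only [_root_.smul_apply, ofMeasure_apply μ hs, ContinuousLinearMap.mul_apply',
      smul_eq_mul, Complex.real_smul]
    ring
  · intro f g _ hf hg hfP hgP
    have h1 : cintegral (c • ofMeasure μ) (f + g) =
        cintegral (c • ofMeasure μ) f + cintegral (c • ofMeasure μ) g :=
      VectorMeasure.integral_add (integrable_smul_ofMeasure c hf) (integrable_smul_ofMeasure c hg)
    rw [h1, hfP, hgP, integral_add' hf hg]
    ring
  · exact isClosed_eq hcont (continuous_const.mul continuous_integral)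
  · intro f g hfg _ hP
    have hac : (c • ofMeasure μ).variation ≪ μ :=
      Measure.absolutelyContinuous_of_le_smul (variation_smul_ofMeasure_le c μ)
    have h1 : cintegral (c • ofMeasure μ) g = cintegral (c • ofMeasure μ) f :=
      VectorMeasure.integral_congr_ae (hac.ae_le hfg.symm)
    rw [h1, hP, integral_congr_ae hfg]

theorem cintegral_sum_smul_ofMeasure {ι : Type*} (s : Finset ι) (c : ι → ℂ) (μ : ι → Measure X)
    [∀ i, IsFiniteMeasure (μ i)] {f : X → ℂ} (hf : ∀ i, Integrable f (μ i)) :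
    cintegral (∑ i ∈ s, c i • ofMeasure (μ i)) f = ∑ i ∈ s, c i * ∫ x, f x ∂(μ i) := by
  rw [cintegral, VectorMeasure.integral_finsetSum_vectorMeasure
    fun i _ => integrable_smul_ofMeasure (c i) (hf i)]
  exact Finset.sum_congr rfl fun i _ => cintegral_smul_ofMeasure (c i) (μ i) (hf i)

theorem variation_conjMeasure_le (ν : ComplexMeasure X) :
    (conjMeasure ν).variation ≤ ν.variation := by
  refine VectorMeasure.variation_le_of_forall_enorm_le fun E _ => ?_
  have : ‖conjMeasure ν E‖ₑ = ‖ν E‖ₑ := by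
    simp only [conjMeasure, VectorMeasure.mapRange_apply, ← ofReal_norm]
    congr 1
    exact RCLike.norm_conj _
  rw [this]
  exact VectorMeasure.enorm_measure_le_variation _ _

theorem conjMeasure_sum_smul_ofMeasure {ι : Type*} (s : Finset ι) (c : ι → ℂ)
    (μ : ι → Measure X) [∀ i, IsFiniteMeasure (μ i)] :
    conjMeasure (∑ i ∈ s, c i • ofMeasure (μ i)) =
      ∑ i ∈ s, (starRingEnd ℂ (c i)) • ofMeasure (μ i) := by
  ext E hE
  simp [conjMeasure, ofMeasure_apply, hE]

end ComplexMeasures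

section Parts

variable {X : Type*} [MeasurableSpace X]

theorem variation_re_le (ν : ComplexMeasure X) :
    (ComplexMeasure.re ν).variation ≤ ν.variation := by
  refine VectorMeasure.variation_le_of_forall_enorm_le fun E _ => ?_
  refine le_trans ?_ (VectorMeasure.enorm_measure_le_variation ν E)
  rw [← ofReal_norm, ← ofReal_norm]
  exact ENNReal.ofReal_le_ofReal (Complex.abs_re_le_norm (ν E))

theorem variation_im_le (ν : ComplexMeasure X) :
    (ComplexMeasure.im ν).variation ≤ ν.variation := by
  refine VectorMeasure.variation_le_of_forall_enorm_le fun E _ => ?_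
  refine le_trans ?_ (VectorMeasure.enorm_measure_le_variation ν E)
  rw [← ofReal_norm, ← ofReal_norm]
  exact ENNReal.ofReal_le_ofReal (Complex.abs_im_le_norm (ν E))

/-- The four positive parts of a complex measure, so that `ν = ∑ i, I ^ i • part ν i`. -/
def part (ν : ComplexMeasure X) : Fin 4 → Measure X :=
  ![(ComplexMeasure.re ν).toJordanDecomposition.posPart,
    (ComplexMeasure.im ν).toJordanDecomposition.posPart,
    (ComplexMeasure.re ν).toJordanDecomposition.negPart,
    (ComplexMeasure.im ν).toJordanDecomposition.negPart]

instance (ν : ComplexMeasure X) (i : Fin 4) : IsFiniteMeasure (part ν i) := by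
  fin_cases i
  · exact (ComplexMeasure.re ν).toJordanDecomposition.posPart_finite
  · exact (ComplexMeasure.im ν).toJordanDecomposition.posPart_finite
  · exact (ComplexMeasure.re ν).toJordanDecomposition.negPart_finite
  · exact (ComplexMeasure.im ν).toJordanDecomposition.negPart_finite

theorem sum_part (ν : ComplexMeasure X) :
    ∑ i : Fin 4, Complex.I ^ (i : ℕ) • ofMeasure (part ν i) = ν := by
  ext E hE
  have hre := (ComplexMeasure.re ν).apply_eq_posPart_real_sub_negPart_real hE
  have him := (ComplexMeasure.im ν).apply_eq_posPart_real_sub_negPart_real hE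
  have hre' : (ComplexMeasure.re ν) E = (ν E).re := rfl
  have him' : (ComplexMeasure.im ν) E = (ν E).im := rfl
  rw [hre'] at hre
  rw [him'] at him
  simp only [Fin.sum_univ_four, _root_.add_apply, _root_.smul_apply, ofMeasure_apply _ hE, part]
  apply Complex.ext
  · simp [hre, pow_succ]; ring
  · simp [him, pow_succ]; ring

theorem part_le_variation (ν : ComplexMeasure X) (i : Fin 4) : part ν i ≤ ν.variation := by
  have hre := variation_re_le ν
  have him := variation_im_le ν
  rw [← SignedMeasure.totalVariation_eq_variation] at hre him
  fin_cases i
  · exact (Measure.le_add_right le_rfl).trans hre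
  · exact (Measure.le_add_right le_rfl).trans him
  · exact (Measure.le_add_left le_rfl).trans hre
  · exact (Measure.le_add_left le_rfl).trans him

theorem variation_sum_smul_ofMeasure_le {ι : Type*} (s : Finset ι) (c : ι → ℂ)
    (μ : ι → Measure X) [∀ i, IsFiniteMeasure (μ i)] :
    (∑ i ∈ s, c i • ofMeasure (μ i)).variation ≤ ∑ i ∈ s, ‖c i‖₊ • μ i :=
  (VectorMeasure.variation_finsetSum_le s _).trans
    (Finset.sum_le_sum fun i _ => variation_smul_ofMeasure_le (c i) (μ i))

instance isFiniteMeasure_variation (ν : ComplexMeasure X) : IsFiniteMeasure ν.variation := by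
  have h := variation_sum_smul_ofMeasure_le Finset.univ (fun i : Fin 4 => Complex.I ^ (i : ℕ))
    (part ν)
  rw [sum_part] at h
  exact isFiniteMeasure_of_le _ h

theorem cintegral_eq_sum_part (ν : ComplexMeasure X) {f : X → ℂ}
    (hf : ∀ i, Integrable f (part ν i)) :
    cintegral ν f = ∑ i : Fin 4, Complex.I ^ (i : ℕ) * ∫ x, f x ∂(part ν i) := by
  conv_lhs => rw [← sum_part ν]
  exact cintegral_sum_smul_ofMeasure _ _ _ hf

theorem cintegral_conjMeasure (ν : ComplexMeasure X) {f : X → ℂ}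
    (hf : ∀ i, Integrable f (part ν i)) :
    cintegral (conjMeasure ν) f =
      starRingEnd ℂ (cintegral ν (fun x => starRingEnd ℂ (f x))) := by
  have hf' : ∀ i, Integrable (fun x => starRingEnd ℂ (f x)) (part ν i) := fun i =>
    Complex.conjLIE.toLinearIsometry.toContinuousLinearMap.integrable_comp (hf i)
  rw [cintegral_eq_sum_part ν hf']
  conv_lhs => rw [← sum_part ν, conjMeasure_sum_smul_ofMeasure]
  rw [cintegral_sum_smul_ofMeasure _ _ _ hf, map_sum]
  refine Finset.sum_congr rfl fun i _ => ?_
  rw [map_mul, integral_conj, Complex.conj_conj]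

variable [TopologicalSpace X] [T2Space X] [BorelSpace X]

theorem regular_part (ν : RegularComplexMeasure X) (i : Fin 4) :
    (part ν.toComplexMeasure i).Regular := by
  have := ν.regular
  exact regular_of_le (part_le_variation ν.toComplexMeasure i)

/-- The regular complex measure `∑ i, c i • μ i`. -/
def regularSum {ι : Type*} [Fintype ι] (c : ι → ℂ) (μ : ι → Measure X)
    [∀ i, IsFiniteMeasure (μ i)] [∀ i, (μ i).Regular] : RegularComplexMeasure X where
  toComplexMeasure := ∑ i, c i • ofMeasure (μ i)
  regular := by
    have : ∀ i, (‖c i‖₊ • μ i).Regular := fun i => Measure.Regular.smul_nnreal _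
    have := regular_finsetSum Finset.univ (μ := fun i => ‖c i‖₊ • μ i)
    exact regular_of_le (variation_sum_smul_ofMeasure_le Finset.univ c μ)

/-- The complex conjugate of a regular complex measure. -/
def conjRegular (ν : RegularComplexMeasure X) : RegularComplexMeasure X where
  toComplexMeasure := conjMeasure ν.toComplexMeasure
  regular := by
    have := ν.regular
    exact regular_of_le (variation_conjMeasure_le ν.toComplexMeasure)

end Parts

section Riesz

variable {X : Type*} [TopologicalSpace X]

/-- A compactly supported real function as a complex function vanishing at infinity. -/
def ofRealCc (f : C_c(X, ℝ)) : C₀(X, ℂ) where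
  toFun x := (f x : ℂ)
  continuous_toFun := Complex.continuous_ofReal.comp f.continuous
  zero_at_infty' :=
    (f.hasCompactSupport.comp_left (g := Complex.ofReal) Complex.ofReal_zero).is_zero_at_infty

@[simp] theorem ofRealCc_apply (f : C_c(X, ℝ)) (x : X) : ofRealCc f x = (f x : ℂ) := rfl

theorem integrable_of_continuous_of_bound {Y : Type*} [TopologicalSpace Y] [MeasurableSpace Y]
    [BorelSpace Y] (μ : Measure Y) [IsFiniteMeasure μ] {f : Y → ℂ} (hf : Continuous f) {C : ℝ}
    (hC : ∀ x, ‖f x‖ ≤ C) : Integrable f μ :=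
  Integrable.of_bound hf.aestronglyMeasurable C (Eventually.of_forall hC)

theorem norm_apply_le_norm {Y : Type*} [TopologicalSpace Y] (ψ : C₀(Y, ℂ)) (x : Y) :
    ‖ψ x‖ ≤ ‖ψ‖ := ψ.toBCF.norm_coe_le_norm x

theorem integrable_zeroAtInfty {Y : Type*} [TopologicalSpace Y] [MeasurableSpace Y]
    [BorelSpace Y] (μ : Measure Y) [IsFiniteMeasure μ] (ψ : C₀(Y, ℂ)) : Integrable ψ μ :=
  integrable_of_continuous_of_bound μ ψ.continuous (norm_apply_le_norm ψ)

theorem norm_le_of_forall_norm_le (ψ : C₀(X, ℂ)) {C : ℝ} (hC : 0 ≤ C) (h : ∀ x, ‖ψ x‖ ≤ C) :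
    ‖ψ‖ ≤ C := by
  rw [← ZeroAtInftyContinuousMap.norm_toBCF_eq_norm]
  exact (BoundedContinuousFunction.norm_le hC).2 h

variable [T2Space X] [LocallyCompactSpace X]

/-- Compactly supported functions are dense in `C₀(X)`. -/
theorem exists_ofRealCc_dist_lt (ψ : C₀(X, ℂ)) {ε : ℝ} (hε : 0 < ε) :
    ∃ f g : C_c(X, ℝ), dist ψ (ofRealCc f + Complex.I • ofRealCc g) < ε := by
  have hsmall : ∀ᶠ x in cocompact X, ‖ψ x‖ < ε / 2 := by
    have := ψ.zero_at_infty'.norm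
    rw [norm_zero] at this
    exact this.eventually_lt_const (half_pos hε)
  obtain ⟨K, hK, hKs⟩ := mem_cocompact.1 hsmall
  obtain ⟨φ, hφK, -, hφc, hφI⟩ :=
    exists_continuous_one_zero_of_isCompact hK isClosed_empty (disjoint_empty K)
  refine ⟨⟨⟨fun x => φ x * (ψ x).re, by fun_prop⟩, hφc.mul_right⟩,
    ⟨⟨fun x => φ x * (ψ x).im, by fun_prop⟩, hφc.mul_right⟩, ?_⟩
  rw [dist_eq_norm]
  refine (norm_le_of_forall_norm_le _ (half_pos hε).le fun x => ?_).trans_lt (half_lt_self hε)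
  have hx : (ψ - (ofRealCc ⟨⟨fun x => φ x * (ψ x).re, by fun_prop⟩, hφc.mul_right⟩ +
      Complex.I • ofRealCc ⟨⟨fun x => φ x * (ψ x).im, by fun_prop⟩, hφc.mul_right⟩)) x =
      ((1 - φ x : ℝ) : ℂ) * ψ x := by
    apply Complex.ext <;> simp <;> ring
  rw [hx, norm_mul, Complex.norm_real]
  by_cases hxK : x ∈ K
  · have h1 : φ x = 1 := hφK hxK
    simpa [h1] using (half_pos hε).le
  · have h1 : ‖1 - φ x‖ ≤ 1 := by
      rw [Real.norm_eq_abs, abs_le]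
      constructor <;> linarith [(hφI x).1, (hφI x).2]
    exact (mul_le_of_le_one_left (norm_nonneg _) h1).trans (hKs hxK).le

variable [MeasurableSpace X] [BorelSpace X]

/-- A regular complex measure is determined by its integrals of functions in `C₀(X)`. -/
theorem regularComplexMeasure_ext {ν₁ ν₂ : RegularComplexMeasure X}
    (h : ∀ ψ : C₀(X, ℂ), cintegral ν₁.toComplexMeasure ψ = cintegral ν₂.toComplexMeasure ψ) :
    ν₁ = ν₂ := by
  have hr₁ := regular_part ν₁
  have hr₂ := regular_part ν₂
  have hsum : ∀ i, part ν₁.toComplexMeasure i + part ν₂.toComplexMeasure (i + 2) =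
      part ν₂.toComplexMeasure i + part ν₁.toComplexMeasure (i + 2) := by
    intro i
    have hr : ∀ (ν ν' : RegularComplexMeasure X),
        (part ν.toComplexMeasure i + part ν'.toComplexMeasure (i + 2)).Regular := fun ν ν' => by
      have := regular_part ν i
      have := regular_part ν' (i + 2)
      exact regular_add
    have := hr ν₁ ν₂
    have := hr ν₂ ν₁
    refine Measure.ext_of_integral_eq_on_compactlySupported fun f => ?_
    have hInt : ∀ (ν : RegularComplexMeasure X) k,
        Integrable (fun x => f x) (part ν.toComplexMeasure k) := fun ν k => by
      have := regular_part ν k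
      exact f.integrable
    rw [integral_add_measure (hInt _ _) (hInt _ _), integral_add_measure (hInt _ _) (hInt _ _)]
    have key := h (ofRealCc f)
    rw [cintegral_eq_sum_part _ fun k => integrable_zeroAtInfty _ _,
      cintegral_eq_sum_part _ fun k => integrable_zeroAtInfty _ _] at key
    simp only [Fin.sum_univ_four, ofRealCc_apply, integral_complex_ofReal] at key
    have kre := congrArg Complex.re key
    have kim := congrArg Complex.im key
    simp [pow_succ] at kre kim
    fin_cases i <;> simp <;> linarith
  have : ν₁.toComplexMeasure = ν₂.toComplexMeasure := by
    rw [← sum_part ν₁.toComplexMeasure, ← sum_part ν₂.toComplexMeasure]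
    ext E hE
    have hE' : ∀ i, (part ν₁.toComplexMeasure i).real E +
        (part ν₂.toComplexMeasure (i + 2)).real E =
        (part ν₂.toComplexMeasure i).real E + (part ν₁.toComplexMeasure (i + 2)).real E := by
      intro i
      rw [← measureReal_add_apply, ← measureReal_add_apply, hsum i]
    have e02 := hE' 0
    have e13 := hE' 1
    simp only [Fin.isValue, zero_add, show (1 : Fin 4) + 2 = 3 from rfl] at e02 e13
    simp only [Fin.sum_univ_four, _root_.add_apply, _root_.smul_apply, ofMeasure_apply _ hE]
    apply Complex.ext
    · simp [pow_succ]; linarith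
    · simp [pow_succ]; linarith
  cases ν₁
  cases ν₂
  congr

/-- The functional `ψ ↦ ∫ ψ dμ` on `C₀(X)`. -/
def integralC0 (μ : Measure X) [IsFiniteMeasure μ] : C₀(X, ℂ) →L[ℂ] ℂ :=
  LinearMap.mkContinuous
    { toFun ψ := ∫ x, ψ x ∂μ
      map_add' ψ φ := integral_add (integrable_zeroAtInfty μ ψ) (integrable_zeroAtInfty μ φ)
      map_smul' c ψ := integral_const_mul c _ }
    (μ.real univ) fun ψ => by
      rw [mul_comm]
      exact norm_integral_le_of_norm_le_const (Eventually.of_forall (norm_apply_le_norm ψ))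

/-- Every positive bounded functional on `C₀(X)` is the integral against a finite regular
measure. -/
theorem exists_measure_of_positive (L : C₀(X, ℂ) →L[ℂ] ℂ) (r : C_c(X, ℝ) → ℝ)
    (hr : ∀ f, L (ofRealCc f) = r f) (hpos : ∀ f, (∀ x, 0 ≤ f x) → 0 ≤ r f) :
    ∃ μ : Measure X, IsFiniteMeasure μ ∧ μ.Regular ∧ ∀ ψ : C₀(X, ℂ), L ψ = ∫ x, ψ x ∂μ := by
  let Λ : C_c(X, ℝ) →ₚ[ℝ] ℝ := PositiveLinearMap.mk₀
    { toFun := r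
      map_add' := fun f g => by
        have : ofRealCc (f + g) = ofRealCc f + ofRealCc g := by ext x; simp
        apply Complex.ofReal_injective
        rw [← hr, this, map_add, hr, hr, Complex.ofReal_add]
      map_smul' := fun c f => by
        have : ofRealCc (c • f) = (c : ℂ) • ofRealCc f := by ext x; simp
        apply Complex.ofReal_injective
        rw [← hr, this, map_smul, hr]
        simp }
    (fun f hf => hpos f hf)
  have hΛ : ∀ f, Λ f = r f := fun f => rfl
  have hfin : IsFiniteMeasure (RealRMK.rieszMeasure Λ) := by
    refine ⟨lt_of_le_of_lt ?_ (ENNReal.ofReal_lt_top (r := ‖L‖))⟩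
    rw [isOpen_univ.measure_eq_iSup_isCompact]
    refine iSup₂_le fun K _ => iSup_le fun hK => ?_
    obtain ⟨φ, hφK, -, hφc, hφI⟩ :=
      exists_continuous_one_zero_of_isCompact hK isClosed_empty (disjoint_empty K)
    refine (RealRMK.rieszMeasure_le_of_eq_one Λ (f := ⟨φ, hφc⟩) (fun x => (hφI x).1) hK
      fun x hx => hφK hx).trans (ENNReal.ofReal_le_ofReal ?_)
    have h1 : ‖ofRealCc ⟨φ, hφc⟩‖ ≤ 1 := norm_le_of_forall_norm_le _ zero_le_one fun x => by
      rw [ofRealCc_apply, Complex.norm_real, Real.norm_eq_abs]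
      exact abs_le.2 ⟨neg_one_lt_zero.le.trans (hφI x).1, (hφI x).2⟩
    calc Λ ⟨φ, hφc⟩ ≤ ‖(r ⟨φ, hφc⟩ : ℂ)‖ := by
          rw [hΛ, Complex.norm_real]; exact le_abs_self _
      _ = ‖L (ofRealCc ⟨φ, hφc⟩)‖ := by rw [hr]
      _ ≤ ‖L‖ * ‖ofRealCc ⟨φ, hφc⟩‖ := L.le_opNorm _
      _ ≤ ‖L‖ := mul_le_of_le_one_right L.opNorm_nonneg h1
  refine ⟨RealRMK.rieszMeasure Λ, hfin, inferInstance, fun ψ => ?_⟩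
  have heq : ∀ f, L (ofRealCc f) = integralC0 (RealRMK.rieszMeasure Λ) (ofRealCc f) := fun f => by
    change _ = ∫ x, (f x : ℂ) ∂_
    rw [integral_complex_ofReal, RealRMK.integral_rieszMeasure, hΛ, hr]
  have hclosed : IsClosed {ψ | L ψ = integralC0 (RealRMK.rieszMeasure Λ) ψ} :=
    isClosed_eq L.continuous (integralC0 _).continuous
  change ψ ∈ {ψ | L ψ = integralC0 (RealRMK.rieszMeasure Λ) ψ}
  rw [← hclosed.closure_eq]
  refine Metric.mem_closure_iff.2 fun ε hε => ?_
  obtain ⟨f, g, hfg⟩ := exists_ofRealCc_dist_lt ψ hε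
  refine ⟨_, ?_, hfg⟩
  simp only [mem_ofPred_eq, map_add, map_smul, heq]

end Riesz

section Fubini

variable {X : Type*} [TopologicalSpace X] [T2Space X] [LocallyCompactSpace X] [MeasurableSpace X]
  [BorelSpace X]

/-- A finite regular measure is almost carried by a compactly supported cutoff function. -/
theorem exists_cutoff (μ : Measure X) [IsFiniteMeasure μ] [μ.Regular] {ε : ℝ} (hε : 0 < ε) :
    ∃ φ : C(X, ℝ), HasCompactSupport φ ∧ (∀ x, φ x ∈ Icc (0 : ℝ) 1) ∧
      ∫ x, (1 - φ x) ∂μ ≤ ε := by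
  obtain ⟨K, -, hK, hlt⟩ := (MeasurableSet.univ (α := X)).exists_isCompact_sdiff_lt
    (measure_ne_top μ univ) (ENNReal.ofReal_pos.2 hε).ne'
  obtain ⟨φ, hφK, -, hφc, hφI⟩ :=
    exists_continuous_one_zero_of_isCompact hK isClosed_empty (disjoint_empty K)
  refine ⟨φ, hφc, hφI, ?_⟩
  have hle : ∀ x, 1 - φ x ≤ (univ \ K).indicator 1 x := fun x => by
    by_cases hx : x ∈ K
    · simp [hx, show φ x = 1 from hφK hx]
    · simp [hx, (hφI x).1]
  have hms : MeasurableSet (univ \ K) := MeasurableSet.univ.diff hK.measurableSet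
  calc ∫ x, (1 - φ x) ∂μ ≤ ∫ x, (univ \ K).indicator 1 x ∂μ :=
        integral_mono_of_nonneg (Eventually.of_forall fun x => sub_nonneg.2 (hφI x).2)
          ((integrable_indicator_iff hms).2 (integrableOn_const (measure_ne_top _ _)))
          (Eventually.of_forall hle)
    _ = μ.real (univ \ K) := integral_indicator_one hms
    _ ≤ ε := ENNReal.toReal_le_of_le_ofReal hε.le hlt.le

variable {Y : Type*} [TopologicalSpace Y]

theorem norm_integral_sub_cutoff_le {X : Type*} [TopologicalSpace X] [MeasurableSpace X]
    [BorelSpace X] (μ : Measure X) [IsFiniteMeasure μ] {C : ℝ} {f : X → ℂ}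
    (hf : Continuous f) (hC : ∀ x, ‖f x‖ ≤ C) {φ : C(X, ℝ)} (hφ : ∀ x, φ x ∈ Icc (0 : ℝ) 1) :
    ‖∫ x, f x ∂μ - ∫ x, (φ x : ℂ) * f x ∂μ‖ ≤ C * ∫ x, (1 - φ x) ∂μ := by
  have hφ1 : ∀ x, ‖(φ x : ℂ) * f x‖ ≤ C := fun x => by
    rw [norm_mul, Complex.norm_real, Real.norm_of_nonneg (hφ x).1]
    exact (mul_le_of_le_one_left (norm_nonneg _) (hφ x).2).trans (hC x)
  rw [← integral_sub (integrable_of_continuous_of_bound μ hf hC)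
    (integrable_of_continuous_of_bound μ (by fun_prop) hφ1), ← integral_const_mul]
  have hInt : Integrable (fun x => C * (1 - φ x)) μ := by
    refine Integrable.of_bound (C := |C|) (by fun_prop) (Eventually.of_forall fun x => ?_)
    rw [norm_mul, Real.norm_eq_abs, Real.norm_of_nonneg (sub_nonneg.2 (hφ x).2)]
    exact mul_le_of_le_one_right (abs_nonneg _) (by linarith [(hφ x).1])
  refine norm_integral_le_of_norm_le hInt (Eventually.of_forall fun x => ?_)
  have : f x - (φ x : ℂ) * f x = ((1 - φ x : ℝ) : ℂ) * f x := by push_cast; ring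
  rw [this, norm_mul, Complex.norm_real, Real.norm_of_nonneg (sub_nonneg.2 (hφ x).2), mul_comm]
  exact mul_le_mul_of_nonneg_right (hC x) (sub_nonneg.2 (hφ x).2)

/-- Integrals of a bounded jointly continuous function against a finite regular measure depend
continuously on the parameter. -/
theorem continuous_integral_of_bound (μ : Measure X) [IsFiniteMeasure μ] [μ.Regular] {C : ℝ}
    {k : X → Y → ℂ} (hk : Continuous k.uncurry) (hC : ∀ x y, ‖k x y‖ ≤ C) :
    Continuous fun y => ∫ x, k x y ∂μ := by
  have hcut : ∀ φ : C(X, ℝ), HasCompactSupport φ →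
      Continuous fun y => ∫ x, (φ x : ℂ) * k x y ∂μ := by
    intro φ hφ
    rw [← continuousOn_univ]
    refine continuousOn_integral_of_compact_support (k := tsupport φ) hφ ?_ ?_
    · refine Continuous.continuousOn ?_
      exact (Complex.continuous_ofReal.comp (φ.continuous.comp continuous_snd)).mul
        (hk.comp continuous_swap)
    · intro y x _ hx
      simp [image_eq_zero_of_notMem_tsupport hx]
  refine continuous_of_uniform_approx_of_continuous fun u hu => ?_
  obtain ⟨ε, hε, hεu⟩ := Metric.mem_uniformity_dist.1 hu
  have hδ : 0 < ε / (|C| + 1) := by positivity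
  obtain ⟨φ, hφc, hφI, hφ⟩ := exists_cutoff μ hδ
  refine ⟨_, hcut φ hφc, fun y => hεu ?_⟩
  rw [dist_eq_norm]
  calc _ ≤ |C| * ∫ x, (1 - φ x) ∂μ := norm_integral_sub_cutoff_le μ (by fun_prop)
          (fun x => (hC x y).trans (le_abs_self C)) hφI
    _ ≤ |C| * (ε / (|C| + 1)) := mul_le_mul_of_nonneg_left hφ (abs_nonneg _)
    _ < ε := by
      rw [mul_div_assoc', div_lt_iff₀ (by positivity)]
      nlinarith [abs_nonneg C]

/-- Integration against a regular complex measure preserves continuity in a parameter. -/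
theorem continuous_cintegral (ν : RegularComplexMeasure X) {C : ℝ} {k : X → Y → ℂ}
    (hk : Continuous k.uncurry) (hC : ∀ x y, ‖k x y‖ ≤ C) :
    Continuous fun y => cintegral ν.toComplexMeasure fun x => k x y := by
  have hreg := regular_part ν
  have : ∀ y, cintegral ν.toComplexMeasure (fun x => k x y) =
      ∑ i : Fin 4, Complex.I ^ (i : ℕ) * ∫ x, k x y ∂(part ν.toComplexMeasure i) := fun y =>
    cintegral_eq_sum_part _ fun i =>
      integrable_of_continuous_of_bound _ (by fun_prop) fun x => hC x y
  simp only [this]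
  exact continuous_finsetSum _ fun i _ =>
    continuous_const.mul (continuous_integral_of_bound _ hk hC)

variable [MeasurableSpace Y] [BorelSpace Y]

theorem cintegral_cintegral_eq_sum (ν : RegularComplexMeasure X) (ν' : RegularComplexMeasure Y)
    {C : ℝ} {k : X → Y → ℂ} (hk : Continuous k.uncurry) (hC : ∀ x y, ‖k x y‖ ≤ C) :
    cintegral ν'.toComplexMeasure (fun y => cintegral ν.toComplexMeasure fun x => k x y) =
      ∑ j : Fin 4, ∑ i : Fin 4, Complex.I ^ (j : ℕ) * Complex.I ^ (i : ℕ) *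
        ∫ y, ∫ x, k x y ∂(part ν.toComplexMeasure i) ∂(part ν'.toComplexMeasure j) := by
  have hreg := regular_part ν
  have hinner : ∀ y, cintegral ν.toComplexMeasure (fun x => k x y) =
      ∑ i : Fin 4, Complex.I ^ (i : ℕ) * ∫ x, k x y ∂(part ν.toComplexMeasure i) := fun y =>
    cintegral_eq_sum_part _ fun i =>
      integrable_of_continuous_of_bound _ (by fun_prop) fun x => hC x y
  have hInt : ∀ i j, Integrable (fun y => ∫ x, k x y ∂(part ν.toComplexMeasure i))
      (part ν'.toComplexMeasure j) := fun i j =>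
    integrable_of_continuous_of_bound _ (continuous_integral_of_bound _ hk hC) fun y =>
      norm_integral_le_of_norm_le_const (Eventually.of_forall fun x => hC x y)
  simp only [hinner]
  rw [cintegral_eq_sum_part _ fun j => integrable_finsetSum _ fun i _ => (hInt i j).const_mul _]
  refine Finset.sum_congr rfl fun j _ => ?_
  rw [integral_finsetSum _ fun i _ => (hInt i j).const_mul _, Finset.mul_sum]
  refine Finset.sum_congr rfl fun i _ => ?_
  rw [integral_const_mul, mul_assoc]

variable [T2Space Y]

theorem norm_cintegral_le {Z : Type*} [MeasurableSpace Z] (ν : ComplexMeasure Z) {C : ℝ}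
    {f : Z → ℂ} (hC : ∀ x, ‖f x‖ ≤ C) :
    ‖cintegral ν f‖ ≤ C * ‖ContinuousLinearMap.mul ℝ ℂ‖ * ν.variation.real univ :=
  VectorMeasure.norm_integral_le_of_norm_le_const (Eventually.of_forall hC)

theorem cintegral_conjRegular_conjRegular (ν : RegularComplexMeasure X)
    (ν' : RegularComplexMeasure Y) {C : ℝ} {k : X → Y → ℂ} (hk : Continuous k.uncurry)
    (hC : ∀ x y, ‖k x y‖ ≤ C) :
    cintegral (conjRegular ν').toComplexMeasure
        (fun y => cintegral (conjRegular ν).toComplexMeasure fun x => k x y) =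
      starRingEnd ℂ (cintegral ν'.toComplexMeasure
        fun y => cintegral ν.toComplexMeasure fun x => starRingEnd ℂ (k x y)) := by
  have hcont := continuous_cintegral (conjRegular ν) hk hC
  have hinner : ∀ y, starRingEnd ℂ (cintegral (conjRegular ν).toComplexMeasure fun x => k x y) =
      cintegral ν.toComplexMeasure fun x => starRingEnd ℂ (k x y) := fun y => by
    have h := cintegral_conjMeasure ν.toComplexMeasure (f := fun x => k x y) fun i =>
      integrable_of_continuous_of_bound _ (by fun_prop) fun x => hC x y
    rw [conjRegular, h, Complex.conj_conj]
  have houter := cintegral_conjMeasure ν'.toComplexMeasure fun i =>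
    integrable_of_continuous_of_bound _ hcont fun y => norm_cintegral_le _ fun x => hC x y
  simp only [hinner] at houter
  exact houter

variable [LocallyCompactSpace Y]

theorem norm_integral_integral_sub_cutoff_le {X : Type*} [TopologicalSpace X]
    [MeasurableSpace X] [BorelSpace X] (μ : Measure X) [IsFiniteMeasure μ]
    (ν : Measure Y) [IsFiniteMeasure ν] [ν.Regular] {C : ℝ} (hC0 : 0 ≤ C) {k : X → Y → ℂ}
    (hk : Continuous k.uncurry) (hC : ∀ x y, ‖k x y‖ ≤ C) {φ : C(X, ℝ)} {χ : C(Y, ℝ)}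
    (hφI : ∀ x, φ x ∈ Icc (0 : ℝ) 1) (hχI : ∀ y, χ y ∈ Icc (0 : ℝ) 1) {ε : ℝ}
    (hφ : ∫ x, (1 - φ x) ∂μ ≤ ε) (hχ : ∫ y, (1 - χ y) ∂ν ≤ ε) :
    ‖∫ x, ∫ y, k x y ∂ν ∂μ - ∫ x, (φ x : ℂ) * ∫ y, (χ y : ℂ) * k x y ∂ν ∂μ‖ ≤
      C * (μ.real univ + ν.real univ) * ε := by
  have hφn : ∀ x, ‖(φ x : ℂ)‖ ≤ 1 := fun x => by
    rw [Complex.norm_real, Real.norm_of_nonneg (hφI x).1]; exact (hφI x).2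
  have hχn : ∀ y, ‖(χ y : ℂ)‖ ≤ 1 := fun y => by
    rw [Complex.norm_real, Real.norm_of_nonneg (hχI y).1]; exact (hχI y).2
  have hχC : ∀ x y, ‖(χ y : ℂ) * k x y‖ ≤ C := fun x y => by
    rw [norm_mul]
    exact (mul_le_of_le_one_left (norm_nonneg _) (hχn y)).trans (hC x y)
  have hI : Continuous fun x => ∫ y, k x y ∂ν :=
    continuous_integral_of_bound ν (k := fun y x => k x y) (hk.comp continuous_swap)
      fun y x => hC x y
  have hIC : ∀ x, ‖∫ y, k x y ∂ν‖ ≤ C * ν.real univ := fun x =>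
    norm_integral_le_of_norm_le_const (Eventually.of_forall (hC x))
  have hJ : Continuous fun x => ∫ y, (χ y : ℂ) * k x y ∂ν :=
    continuous_integral_of_bound ν (k := fun y x => (χ y : ℂ) * k x y)
      (by simp only [Function.uncurry_def]; fun_prop) fun y x => hχC x y
  have hJC : ∀ x, ‖∫ y, (χ y : ℂ) * k x y ∂ν‖ ≤ C * ν.real univ := fun x =>
    norm_integral_le_of_norm_le_const (Eventually.of_forall (hχC x))
  have hφmul : ∀ {F : X → ℂ}, Continuous F → (∀ x, ‖F x‖ ≤ C * ν.real univ) →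
      Integrable (fun x => (φ x : ℂ) * F x) μ := fun {F} hF hFC => by
    refine integrable_of_continuous_of_bound μ (C := C * ν.real univ) (by fun_prop) fun x => ?_
    rw [norm_mul]
    exact (mul_le_of_le_one_left (norm_nonneg _) (hφn x)).trans (hFC x)
  have h1 : ‖∫ x, ∫ y, k x y ∂ν ∂μ - ∫ x, (φ x : ℂ) * ∫ y, k x y ∂ν ∂μ‖ ≤
      C * ν.real univ * ε :=
    (norm_integral_sub_cutoff_le μ hI hIC hφI).trans (mul_le_mul_of_nonneg_left hφ (by positivity))
  have h2 : ‖∫ x, (φ x : ℂ) * ∫ y, k x y ∂ν ∂μ -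
      ∫ x, (φ x : ℂ) * ∫ y, (χ y : ℂ) * k x y ∂ν ∂μ‖ ≤ C * ε * μ.real univ := by
    rw [← integral_sub (hφmul hI hIC) (hφmul hJ hJC)]
    refine norm_integral_le_of_norm_le_const (Eventually.of_forall fun x => ?_)
    rw [← mul_sub, norm_mul]
    refine (mul_le_of_le_one_left (norm_nonneg _) (hφn x)).trans ?_
    exact (norm_integral_sub_cutoff_le ν (f := fun y => k x y) (by fun_prop) (hC x) hχI).trans
      (mul_le_mul_of_nonneg_left hχ hC0)
  refine (norm_sub_le_norm_sub_add_norm_sub _ _ _).trans ((add_le_add h1 h2).trans_eq ?_)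
  ring

/-- Fubini's theorem for bounded continuous functions and finite regular measures, which need not
be defined on the product Borel structure. -/
theorem integral_integral_swap_of_bound (μ : Measure X) [IsFiniteMeasure μ] [μ.Regular]
    (ν : Measure Y) [IsFiniteMeasure ν] [ν.Regular] {C : ℝ} {k : X → Y → ℂ}
    (hk : Continuous k.uncurry) (hC : ∀ x y, ‖k x y‖ ≤ C) :
    ∫ x, ∫ y, k x y ∂ν ∂μ = ∫ y, ∫ x, k x y ∂μ ∂ν := by
  have hC' : ∀ x y, ‖k x y‖ ≤ |C| := fun x y => (hC x y).trans (le_abs_self C)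
  have main : ∀ ε > 0, ‖∫ x, ∫ y, k x y ∂ν ∂μ - ∫ y, ∫ x, k x y ∂μ ∂ν‖ ≤
      2 * |C| * (μ.real univ + ν.real univ) * ε := by
    intro ε hε
    obtain ⟨φ, hφc, hφI, hφ⟩ := exists_cutoff μ hε
    obtain ⟨χ, hχc, hχI, hχ⟩ := exists_cutoff ν hε
    have swap : ∫ x, (φ x : ℂ) * ∫ y, (χ y : ℂ) * k x y ∂ν ∂μ =
        ∫ y, (χ y : ℂ) * ∫ x, (φ x : ℂ) * k x y ∂μ ∂ν := by
      simp only [← integral_const_mul]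
      rw [integral_integral_swap_of_hasCompactSupport]
      · congr 1 with y
        congr 1 with x
        ring
      · simp only [Function.uncurry_def]
        fun_prop
      · refine HasCompactSupport.intro (hφc.prod hχc) fun p hp => ?_
        rw [mem_prod, not_and_or] at hp
        rcases hp with hp | hp
        · simp [Function.uncurry, image_eq_zero_of_notMem_tsupport hp]
        · simp [Function.uncurry, image_eq_zero_of_notMem_tsupport hp]
    have h1 := norm_integral_integral_sub_cutoff_le μ ν (abs_nonneg C) hk hC' hφI hχI hφ hχ
    have h2 := norm_integral_integral_sub_cutoff_le ν μ (k := fun y x => k x y) (abs_nonneg C)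
      (hk.comp continuous_swap) (fun y x => hC' x y) hχI hφI hχ hφ
    rw [swap] at h1
    rw [norm_sub_rev] at h2
    refine (norm_sub_le_norm_sub_add_norm_sub _ _ _).trans ((add_le_add h1 h2).trans_eq ?_)
    ring
  have hlim : Tendsto (fun ε : ℝ => 2 * |C| * (μ.real univ + ν.real univ) * ε) (𝓝[>] 0) (𝓝 0) := by
    have : Continuous fun ε : ℝ => 2 * |C| * (μ.real univ + ν.real univ) * ε := by fun_prop
    simpa using (this.tendsto 0).mono_left nhdsWithin_le_nhds
  refine sub_eq_zero.1 (norm_le_zero_iff.1 (ge_of_tendsto hlim ?_))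
  exact eventually_nhdsWithin_of_forall fun ε hε => main ε hε

theorem cintegral_swap (ν : RegularComplexMeasure X) (ν' : RegularComplexMeasure Y)
    {C : ℝ} {k : X → Y → ℂ} (hk : Continuous k.uncurry) (hC : ∀ x y, ‖k x y‖ ≤ C) :
    cintegral ν'.toComplexMeasure (fun y => cintegral ν.toComplexMeasure fun x => k x y) =
      cintegral ν.toComplexMeasure (fun x => cintegral ν'.toComplexMeasure fun y => k x y) := by
  have hreg := regular_part ν
  have hreg' := regular_part ν'
  rw [cintegral_cintegral_eq_sum ν ν' hk hC, cintegral_cintegral_eq_sum ν' ν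
    (k := fun y x => k x y) (hk.comp continuous_swap) (fun y x => hC x y), Finset.sum_comm]
  refine Finset.sum_congr rfl fun i _ => Finset.sum_congr rfl fun j _ => ?_
  rw [integral_integral_swap_of_bound _ _ hk hC, mul_comm (Complex.I ^ (j : ℕ))]

end Fubini

section ZeroAtInfinity

variable {G : Type*} [Group G] [TopologicalSpace G] {H : Subgroup G}

theorem exists_isCompact_norm_lt (ψ : C₀(G ⧸ H, ℂ)) {ε : ℝ} (hε : 0 < ε) :
    ∃ L : Set (G ⧸ H), IsCompact L ∧ ∀ x, ε ≤ ‖ψ x‖ → x ∈ L := by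
  have h := ψ.zero_at_infty'.norm
  rw [norm_zero] at h
  obtain ⟨L, hL, hLs⟩ := mem_cocompact.1 (h.eventually_lt_const hε)
  refine ⟨L, hL, fun x hx => ?_⟩
  by_contra hxL
  exact absurd (hLs hxL) (not_lt.2 hx)

theorem eventually_cocompact_quotient {P : G ⧸ H → Prop}
    (h : ∀ᶠ g : G in cocompact G, P (g : G ⧸ H)) : ∀ᶠ x in cocompact (G ⧸ H), P x := by
  obtain ⟨K, hK, hKP⟩ := mem_cocompact.1 h
  refine mem_cocompact.2 ⟨((↑) : G → G ⧸ H) '' K, hK.image QuotientGroup.continuous_mk, ?_⟩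
  intro x hx
  induction x using QuotientGroup.induction_on with
  | H g => exact hKP fun hg => hx ⟨g, hg, rfl⟩

theorem eventually_forall_norm_smul_lt [IsTopologicalGroup G] (ψ : C₀(G ⧸ H, ℂ)) {S : Set G}
    (hS : IsCompact S) {ε : ℝ} (hε : 0 < ε) : ∀ᶠ y in cocompact (G ⧸ H), ∀ s ∈ S, ‖ψ (s • y)‖ < ε := by
  obtain ⟨L, hL, hLs⟩ := exists_isCompact_norm_lt ψ hε
  refine mem_cocompact.2 ⟨S⁻¹ • L, hS.inv.smul_set hL, fun y hy s hs => ?_⟩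
  by_contra! hle
  refine hy (mem_smul.2 ⟨s⁻¹, inv_mem_inv.2 hs, s • y, hLs _ hle, inv_smul_smul s y⟩)

variable [CompactSpace H]

theorem isCompact_subgroup : IsCompact (H : Set G) := isCompact_iff_compactSpace.2 inferInstance

variable [IsTopologicalGroup G]

theorem isProperMap_mk : IsProperMap ((↑) : G → G ⧸ H) := by
  refine isProperMap_iff_isClosedMap_and_compact_fibers.2
    ⟨QuotientGroup.continuous_mk, QuotientGroup.isClosedMap_coe isCompact_subgroup, fun y => ?_⟩
  induction y using QuotientGroup.induction_on with
  | H g =>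
    have : ((↑) : G → G ⧸ H) ⁻¹' {(g : G ⧸ H)} = (fun x => g * x) '' (H : Set G) := by
      ext x
      simp only [mem_preimage, mem_singleton_iff, image_mul_left, SetLike.mem_coe]
      rw [eq_comm, QuotientGroup.eq]
    rw [this]
    exact isCompact_subgroup.image (continuous_const_mul g)

theorem tendsto_mk_cocompact : Tendsto ((↑) : G → G ⧸ H) (cocompact G) (cocompact (G ⧸ H)) :=
  CocompactMap.tendsto_of_forall_preimage fun _ hs => isProperMap_mk.isCompact_preimage hs

theorem eventually_forall_norm_mul_lt (ψ : C₀(G ⧸ H, ℂ)) {S : Set G} (hS : IsCompact S) {ε : ℝ}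
    (hε : 0 < ε) : ∀ᶠ g in cocompact G, ∀ s ∈ S, ‖ψ ((g * s : G) : G ⧸ H)‖ < ε := by
  obtain ⟨L, hL, hLs⟩ := exists_isCompact_norm_lt ψ hε
  refine mem_cocompact.2 ⟨((↑) ⁻¹' L) * S⁻¹, (isProperMap_mk.isCompact_preimage hL).mul hS.inv,
    fun g hg s hs => ?_⟩
  by_contra! hle
  exact hg (mem_mul.2 ⟨g * s, hLs _ hle, s⁻¹, inv_mem_inv.2 hs, mul_inv_cancel_right g s⟩)

end ZeroAtInfinity

section Kernels

variable {G : Type*} [Group G] [TopologicalSpace G] [IsTopologicalGroup G]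
  [MeasurableSpace G] [BorelSpace G] (H : Subgroup G) [CompactSpace H]

instance : IsProbabilityMeasure (haarProb H) :=
  ⟨by simpa [haarProb] using
    Measure.haarMeasure_self (K₀ := (⊤ : TopologicalSpace.PositiveCompacts H))⟩

instance : (haarProb H).IsHaarMeasure := by unfold haarProb; infer_instance

instance : (haarProb H).IsMulRightInvariant where
  map_mul_right_eq_self g := by
    have : IsProbabilityMeasure (Measure.map (· * g) (haarProb H)) :=
      Measure.isProbabilityMeasure_map (continuous_mul_const g).measurable.aemeasurable
    exact Measure.isHaarMeasure_eq_of_isProbabilityMeasure _ _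

instance : (haarProb H).IsInvInvariant where
  inv_eq_self := by
    have : (haarProb H).inv.IsHaarMeasure := {}
    have : IsProbabilityMeasure (haarProb H).inv :=
      Measure.isProbabilityMeasure_map continuous_inv.measurable.aemeasurable
    exact Measure.isHaarMeasure_eq_of_isProbabilityMeasure _ _

variable {H}

theorem continuous_integral_haarProb {A : Type*} [TopologicalSpace A] {F : A → H → ℂ}
    (hF : Continuous F.uncurry) : Continuous fun a => ∫ h, F a h ∂(haarProb H) := by
  rw [← continuousOn_univ]
  exact continuousOn_integral_of_compact_support isCompact_univ hF.continuousOn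
    fun _ _ _ hx => absurd (mem_univ _) hx

theorem norm_integral_haarProb_le {F : H → ℂ} {C : ℝ} (hC : ∀ h, ‖F h‖ ≤ C) :
    ‖∫ h, F h ∂(haarProb H)‖ ≤ C := by
  simpa using norm_integral_le_of_norm_le_const (μ := haarProb H) (Eventually.of_forall hC)

theorem convKernel_mk (ψ : G ⧸ H → ℂ) (g : G) (y : G ⧸ H) :
    convKernel H ψ (g : G ⧸ H) y = ∫ h : H, ψ ((g * (h : G)) • y) ∂(haarProb H) := rfl

theorem invKernel_mk (ψ : G ⧸ H → ℂ) (g : G) :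
    invKernel H ψ (g : G ⧸ H) =
      ∫ h : H, ψ (((h : G)⁻¹ * g⁻¹ : G) : G ⧸ H) ∂(haarProb H) := rfl

theorem continuous_convKernel {ψ : G ⧸ H → ℂ} (hψ : Continuous ψ) :
    Continuous (convKernel H ψ).uncurry := by
  rw [← (QuotientGroup.isOpenQuotientMap_mk.prodMap IsOpenQuotientMap.id).continuous_comp_iff]
  refine continuous_integral_haarProb
    (F := fun (p : G × (G ⧸ H)) (h : H) => ψ ((p.1 * (h : G)) • p.2)) ?_
  simp only [Function.uncurry_def]
  fun_prop

theorem continuous_invKernel_uncurry {A : Type*} [TopologicalSpace A] {F : G ⧸ H → A → ℂ}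
    (hF : Continuous F.uncurry) :
    Continuous (fun (x : G ⧸ H) (a : A) => invKernel H (fun z => F z a) x).uncurry := by
  rw [← (QuotientGroup.isOpenQuotientMap_mk.prodMap IsOpenQuotientMap.id).continuous_comp_iff]
  refine continuous_integral_haarProb
    (F := fun (p : G × A) (h : H) => F (((h : G)⁻¹ * p.1⁻¹ : G) : G ⧸ H) p.2) ?_
  refine hF.comp (Continuous.prodMk (QuotientGroup.continuous_mk.comp ?_) ?_) <;> fun_prop

theorem continuous_invKernel {ψ : G ⧸ H → ℂ} (hψ : Continuous ψ) :
    Continuous (invKernel H ψ) := by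
  have := continuous_invKernel_uncurry (F := fun z (_ : Unit) => ψ z) (hψ.comp continuous_fst)
  exact this.comp (Continuous.prodMk_left ())

theorem norm_convKernel_le {ψ : G ⧸ H → ℂ} {C : ℝ} (hC : ∀ x, ‖ψ x‖ ≤ C) (x y : G ⧸ H) :
    ‖convKernel H ψ x y‖ ≤ C := by
  induction x using QuotientGroup.induction_on with
  | H g => exact norm_integral_haarProb_le fun h => hC _

theorem norm_invKernel_le {ψ : G ⧸ H → ℂ} {C : ℝ} (hC : ∀ x, ‖ψ x‖ ≤ C) (x : G ⧸ H) :
    ‖invKernel H ψ x‖ ≤ C := by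
  induction x using QuotientGroup.induction_on with
  | H g => exact norm_integral_haarProb_le fun h => hC _

theorem tendsto_zero_of_forall_eventually {A : Type*} {l : Filter A} {f : A → ℂ}
    (h : ∀ ε : ℝ, 0 < ε → ∀ᶠ a in l, ‖f a‖ ≤ ε) : Tendsto f l (𝓝 0) := by
  refine Metric.tendsto_nhds.2 fun ε hε => (h (ε / 2) (half_pos hε)).mono fun a ha => ?_
  rw [dist_zero_right]
  exact ha.trans_lt (half_lt_self hε)

/-- `invKernel` preserves `C₀(G/H)`. -/
def invKernelC0 (ψ : C₀(G ⧸ H, ℂ)) : C₀(G ⧸ H, ℂ) where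
  toFun := invKernel H ψ
  continuous_toFun := continuous_invKernel ψ.continuous
  zero_at_infty' := tendsto_zero_of_forall_eventually fun ε hε => by
    refine eventually_cocompact_quotient ?_
    have hinv : Tendsto (fun g : G => ((g⁻¹ : G) : G ⧸ H)) (cocompact G) (cocompact (G ⧸ H)) :=
      tendsto_mk_cocompact.comp (Homeomorph.inv G).isClosedEmbedding.tendsto_cocompact
    filter_upwards [hinv.eventually
      (eventually_forall_norm_smul_lt ψ (isCompact_subgroup (H := H)) hε)] with g hg
    exact norm_integral_haarProb_le fun h => (hg _ (H.inv_mem h.2)).le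

/-- `x ↦ convKernel H ψ x y` as an element of `C₀(G/H)`. -/
def convKernelC0 (ψ : C₀(G ⧸ H, ℂ)) (y : G ⧸ H) : C₀(G ⧸ H, ℂ) where
  toFun x := convKernel H ψ x y
  continuous_toFun := (continuous_convKernel ψ.continuous).comp (Continuous.prodMk_left y)
  zero_at_infty' := tendsto_zero_of_forall_eventually fun ε hε => by
    refine eventually_cocompact_quotient ?_
    induction y using QuotientGroup.induction_on with
    | H b =>
      filter_upwards [eventually_forall_norm_mul_lt ψ
        ((isCompact_subgroup (H := H)).image (continuous_mul_const b)) hε] with g hg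
      refine norm_integral_haarProb_le fun h => ?_
      have := hg _ ⟨h, h.2, rfl⟩
      rw [← mul_assoc] at this
      exact this.le

/-- The function `(xH, yH) ↦ ∫_H ∫_H ψ(h⁻¹ x⁻¹ k y H) dk dh`. -/
def invConvKernel (ψ : G ⧸ H → ℂ) (x y : G ⧸ H) : ℂ :=
  invKernel H (fun z => convKernel H ψ z y) x

theorem continuous_invConvKernel {ψ : G ⧸ H → ℂ} (hψ : Continuous ψ) :
    Continuous (invConvKernel ψ).uncurry :=
  continuous_invKernel_uncurry (continuous_convKernel hψ)

theorem norm_invConvKernel_le {ψ : G ⧸ H → ℂ} {C : ℝ} (hC : ∀ x, ‖ψ x‖ ≤ C) (x y : G ⧸ H) :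
    ‖invConvKernel ψ x y‖ ≤ C :=
  norm_invKernel_le (fun z => norm_convKernel_le hC z y) x

theorem invConvKernel_mk (ψ : G ⧸ H → ℂ) (a : G) (y : G ⧸ H) :
    invConvKernel ψ (a : G ⧸ H) y =
      ∫ h : H, ∫ k : H, ψ (((h : G)⁻¹ * a⁻¹ * (k : G)) • y) ∂(haarProb H) ∂(haarProb H) := rfl

/-- `y ↦ invConvKernel ψ x y` as an element of `C₀(G/H)`. -/
def invConvKernelC0 (ψ : C₀(G ⧸ H, ℂ)) (x : G ⧸ H) : C₀(G ⧸ H, ℂ) where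
  toFun y := invConvKernel ψ x y
  continuous_toFun := (continuous_invConvKernel ψ.continuous).comp (Continuous.prodMk_right x)
  zero_at_infty' := tendsto_zero_of_forall_eventually fun ε hε => by
    induction x using QuotientGroup.induction_on with
    | H a =>
      have hS : IsCompact ((H : Set G) * {a⁻¹} * (H : Set G)) :=
        (isCompact_subgroup.mul isCompact_singleton).mul isCompact_subgroup
      filter_upwards [eventually_forall_norm_smul_lt ψ hS hε] with y hy
      refine norm_integral_haarProb_le fun h => norm_integral_haarProb_le fun k => ?_
      exact (hy _ (mul_mem_mul (mul_mem_mul (H.inv_mem h.2) rfl) k.2)).le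

theorem invKernel_invConvKernel {ψ : G ⧸ H → ℂ} (hψ : Continuous ψ) (x y : G ⧸ H) :
    invKernel H (invConvKernel ψ x) y =
      starRingEnd ℂ (convKernel H (fun z => starRingEnd ℂ (invKernel H ψ z)) y x) := by
  induction x using QuotientGroup.induction_on with
  | H a =>
  induction y using QuotientGroup.induction_on with
  | H b =>
  rw [invKernel_mk, convKernel_mk, integral_conj, Complex.conj_conj]
  have hL : ∀ h' : H, invConvKernel ψ (a : G ⧸ H) (((h' : G)⁻¹ * b⁻¹ : G) : G ⧸ H) =
      ∫ h : H, ∫ k : H, ψ (((h : G)⁻¹ * a⁻¹ * (k : G) * b⁻¹ : G) : G ⧸ H)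
        ∂(haarProb H) ∂(haarProb H) := by
    intro h'
    rw [invConvKernel_mk]
    congr 1 with h
    rw [← integral_mul_right_eq_self _ h']
    congr 1 with k
    change ψ (((_ : G) : G ⧸ H)) = _
    congr 2
    simp only [Subgroup.coe_mul, smul_eq_mul]
    group
  simp only [hL, integral_const, probReal_univ, one_smul]
  rw [integral_integral_swap_of_hasCompactSupport]
  · rw [← integral_inv_eq_self]
    congr 1 with k
    change _ = invKernel H ψ ((b * (k : G) * a : G) : G ⧸ H)
    rw [invKernel_mk]
    congr 1 with h
    congr 2
    simp only [Subgroup.coe_inv]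
    group
  · refine hψ.comp (QuotientGroup.continuous_mk.comp ?_)
    fun_prop
  · exact HasCompactSupport.of_compactSpace _

end Kernels

section Existence

variable {G : Type*} [Group G] [TopologicalSpace G] [IsTopologicalGroup G]
  [MeasurableSpace G] [BorelSpace G] {H : Subgroup G} [CompactSpace H]

theorem convKernel_add {ψ φ : G ⧸ H → ℂ} (hψ : Continuous ψ) (hφ : Continuous φ) (x y : G ⧸ H) :
    convKernel H (ψ + φ) x y = convKernel H ψ x y + convKernel H φ x y := by
  induction x using QuotientGroup.induction_on with
  | H g =>
    have hInt : ∀ {χ : G ⧸ H → ℂ}, Continuous χ →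
        Integrable (fun h : H => χ ((g * (h : G)) • y)) (haarProb H) := fun {χ} hχ =>
      Continuous.integrable_of_hasCompactSupport (by fun_prop) (HasCompactSupport.of_compactSpace _)
    exact integral_add (hInt hψ) (hInt hφ)

theorem convKernel_smul (c : ℂ) (ψ : G ⧸ H → ℂ) (x y : G ⧸ H) :
    convKernel H (c • ψ) x y = c * convKernel H ψ x y := by
  induction x using QuotientGroup.induction_on with
  | H g => exact integral_const_mul c _

theorem convKernel_ofReal (f : G ⧸ H → ℝ) (x y : G ⧸ H) :
    convKernel H (fun z => (f z : ℂ)) x y = ((convKernel H (fun z => (f z : ℂ)) x y).re : ℂ) := by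
  induction x using QuotientGroup.induction_on with
  | H g => rw [convKernel_mk, integral_complex_ofReal, Complex.ofReal_re]

theorem re_convKernel_nonneg {f : G ⧸ H → ℝ} (hf : ∀ z, 0 ≤ f z) (x y : G ⧸ H) :
    0 ≤ (convKernel H (fun z => (f z : ℂ)) x y).re := by
  induction x using QuotientGroup.induction_on with
  | H g =>
    rw [convKernel_mk, integral_complex_ofReal, Complex.ofReal_re]
    exact integral_nonneg fun h => hf _

theorem invKernel_add {ψ φ : G ⧸ H → ℂ} (hψ : Continuous ψ) (hφ : Continuous φ) (x : G ⧸ H) :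
    invKernel H (ψ + φ) x = invKernel H ψ x + invKernel H φ x := by
  induction x using QuotientGroup.induction_on with
  | H g =>
    have hInt : ∀ {χ : G ⧸ H → ℂ}, Continuous χ →
        Integrable (fun h : H => χ (((h : G)⁻¹ * g⁻¹ : G) : G ⧸ H)) (haarProb H) := fun {χ} hχ =>
      Continuous.integrable_of_hasCompactSupport
        (hχ.comp (QuotientGroup.continuous_mk.comp (by fun_prop)))
        (HasCompactSupport.of_compactSpace _)
    exact integral_add (hInt hψ) (hInt hφ)

theorem invKernel_smul (c : ℂ) (ψ : G ⧸ H → ℂ) (x : G ⧸ H) :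
    invKernel H (c • ψ) x = c * invKernel H ψ x := by
  induction x using QuotientGroup.induction_on with
  | H g => exact integral_const_mul c _

theorem invKernel_ofReal (f : G ⧸ H → ℝ) (x : G ⧸ H) :
    invKernel H (fun z => (f z : ℂ)) x = ((invKernel H (fun z => (f z : ℂ)) x).re : ℂ) := by
  induction x using QuotientGroup.induction_on with
  | H g => rw [invKernel_mk, integral_complex_ofReal, Complex.ofReal_re]

theorem re_invKernel_nonneg {f : G ⧸ H → ℝ} (hf : ∀ z, 0 ≤ f z) (x : G ⧸ H) :
    0 ≤ (invKernel H (fun z => (f z : ℂ)) x).re := by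
  induction x using QuotientGroup.induction_on with
  | H g =>
    rw [invKernel_mk, integral_complex_ofReal, Complex.ofReal_re]
    exact integral_nonneg fun h => hf _

variable [LocallyCompactSpace G] [T2Space G] [MeasurableSpace (G ⧸ H)] [BorelSpace (G ⧸ H)]

instance t2Space_quotient : T2Space (G ⧸ H) := by
  have : IsClosed (H : Set G) := isCompact_subgroup.isClosed
  infer_instance

theorem exists_measure_invKernel (μ : Measure (G ⧸ H)) [IsFiniteMeasure μ] :
    ∃ κ : Measure (G ⧸ H), IsFiniteMeasure κ ∧ κ.Regular ∧
      ∀ ψ : C₀(G ⧸ H, ℂ), ∫ x, ψ x ∂κ = ∫ x, invKernel H ψ x ∂μ := by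
  have hInt : ∀ ψ : C₀(G ⧸ H, ℂ), Integrable (invKernel H ψ) μ := fun ψ =>
    integrable_of_continuous_of_bound μ (continuous_invKernel (map_continuous ψ))
      (norm_invKernel_le (norm_apply_le_norm ψ))
  let L : C₀(G ⧸ H, ℂ) →L[ℂ] ℂ := LinearMap.mkContinuous
    { toFun ψ := ∫ x, invKernel H ψ x ∂μ
      map_add' ψ φ := by
        rw [← integral_add (hInt ψ) (hInt φ)]
        congr 1 with x
        exact invKernel_add (map_continuous ψ) (map_continuous φ) x
      map_smul' c ψ := by
        rw [RingHom.id_apply, smul_eq_mul, ← integral_const_mul]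
        congr 1 with x
        exact invKernel_smul c ψ x }
    (μ.real univ) fun ψ => by
      rw [mul_comm]
      exact norm_integral_le_of_norm_le_const
        (Eventually.of_forall (norm_invKernel_le (norm_apply_le_norm ψ)))
  obtain ⟨κ, hκ, hκr, h⟩ := exists_measure_of_positive L
    (fun f => ∫ x, (invKernel H (fun z => (f z : ℂ)) x).re ∂μ)
    (fun f => by
      rw [← integral_complex_ofReal]
      change ∫ x, invKernel H (fun z => (f z : ℂ)) x ∂μ = _
      congr 1 with x
      exact invKernel_ofReal f x)
    (fun f hf => integral_nonneg (re_invKernel_nonneg hf))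
  exact ⟨κ, hκ, hκr, fun ψ => (h ψ).symm⟩

theorem exists_measure_convKernel (μ μ' : Measure (G ⧸ H)) [IsFiniteMeasure μ]
    [IsFiniteMeasure μ'] [μ.Regular] :
    ∃ κ : Measure (G ⧸ H), IsFiniteMeasure κ ∧ κ.Regular ∧
      ∀ ψ : C₀(G ⧸ H, ℂ), ∫ x, ψ x ∂κ = ∫ y, ∫ x, convKernel H ψ x y ∂μ ∂μ' := by
  have hInt : ∀ (ψ : C₀(G ⧸ H, ℂ)) y, Integrable (fun x => convKernel H ψ x y) μ := fun ψ y =>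
    integrable_of_continuous_of_bound μ (convKernelC0 ψ y).continuous
      fun x => norm_convKernel_le (norm_apply_le_norm ψ) x y
  have hbound : ∀ (ψ : C₀(G ⧸ H, ℂ)) y,
      ‖∫ x, convKernel H ψ x y ∂μ‖ ≤ ‖ψ‖ * μ.real univ := fun ψ y =>
    norm_integral_le_of_norm_le_const
      (Eventually.of_forall fun x => norm_convKernel_le (norm_apply_le_norm ψ) x y)
  have hInt' : ∀ ψ : C₀(G ⧸ H, ℂ), Integrable (fun y => ∫ x, convKernel H ψ x y ∂μ) μ' := fun ψ =>
    integrable_of_continuous_of_bound μ'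
      (continuous_integral_of_bound μ (continuous_convKernel (map_continuous ψ))
        (norm_convKernel_le (norm_apply_le_norm ψ))) (hbound ψ)
  let L : C₀(G ⧸ H, ℂ) →L[ℂ] ℂ := LinearMap.mkContinuous
    { toFun ψ := ∫ y, ∫ x, convKernel H ψ x y ∂μ ∂μ'
      map_add' ψ φ := by
        rw [← integral_add (hInt' ψ) (hInt' φ)]
        congr 1 with y
        rw [← integral_add (hInt ψ y) (hInt φ y)]
        congr 1 with x
        exact convKernel_add (map_continuous ψ) (map_continuous φ) x y
      map_smul' c ψ := by
        rw [RingHom.id_apply, smul_eq_mul, ← integral_const_mul]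
        congr 1 with y
        rw [← integral_const_mul]
        congr 1 with x
        exact convKernel_smul c ψ x y }
    (μ.real univ * μ'.real univ) fun ψ => by
      rw [mul_comm, ← mul_assoc]
      exact norm_integral_le_of_norm_le_const (Eventually.of_forall (hbound ψ))
  obtain ⟨κ, hκ, hκr, h⟩ := exists_measure_of_positive L
    (fun f => ∫ y, ∫ x, (convKernel H (fun z => (f z : ℂ)) x y).re ∂μ ∂μ')
    (fun f => by
      simp only [← integral_complex_ofReal]
      change ∫ y, ∫ x, convKernel H (fun z => (f z : ℂ)) x y ∂μ ∂μ' = _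
      congr 1 with y
      congr 1 with x
      exact convKernel_ofReal f x y)
    (fun f hf => integral_nonneg fun y => integral_nonneg fun x => re_convKernel_nonneg hf x y)
  exact ⟨κ, hκ, hκr, fun ψ => (h ψ).symm⟩

theorem exists_isInvol (lam : RegularComplexMeasure (G ⧸ H)) : ∃ κ, IsInvol lam κ := by
  choose κ hfin hreg hκ using fun i =>
    exists_measure_invKernel (H := H) (part (conjMeasure lam.toComplexMeasure) i)
  refine ⟨regularSum (fun i : Fin 4 => Complex.I ^ (i : ℕ)) κ, fun ψ => ?_⟩
  rw [cintegral_eq_sum_part _ fun i => integrable_of_continuous_of_bound _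
    (continuous_invKernel (map_continuous ψ)) (norm_invKernel_le (norm_apply_le_norm ψ)),
    regularSum,
    cintegral_sum_smul_ofMeasure _ _ _ fun i => integrable_zeroAtInfty _ ψ]
  simp only [hκ]

theorem exists_isConv (lam lam' : RegularComplexMeasure (G ⧸ H)) : ∃ κ, IsConv lam lam' κ := by
  have hreg := regular_part lam
  choose κ hfin hreg hκ using fun p : Fin 4 × Fin 4 =>
    exists_measure_convKernel (H := H) (part lam.toComplexMeasure p.2)
      (part lam'.toComplexMeasure p.1)
  refine ⟨regularSum (fun p => Complex.I ^ (p.1 : ℕ) * Complex.I ^ (p.2 : ℕ)) κ, fun ψ => ?_⟩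
  rw [cintegral_cintegral_eq_sum lam lam' (continuous_convKernel (map_continuous ψ))
    (norm_convKernel_le (norm_apply_le_norm ψ)), regularSum,
    cintegral_sum_smul_ofMeasure _ _ _ fun i => integrable_zeroAtInfty _ ψ, Fintype.sum_prod_type]
  simp only [hκ]

theorem isInvol_invol (lam : RegularComplexMeasure (G ⧸ H)) : IsInvol lam (invol lam) :=
  Classical.epsilon_spec (exists_isInvol lam)

theorem isConv_conv (lam lam' : RegularComplexMeasure (G ⧸ H)) :
    IsConv lam lam' (conv lam lam') :=
  Classical.epsilon_spec (exists_isConv lam lam')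

theorem existsUnique_isInvol (lam : RegularComplexMeasure (G ⧸ H)) : ∃! κ, IsInvol lam κ :=
  ⟨_, isInvol_invol lam, fun _ hκ =>
    regularComplexMeasure_ext fun ψ => (hκ ψ).trans (isInvol_invol lam ψ).symm⟩

theorem existsUnique_isConv (lam lam' : RegularComplexMeasure (G ⧸ H)) :
    ∃! κ, IsConv lam lam' κ :=
  ⟨_, isConv_conv lam lam', fun _ hκ =>
    regularComplexMeasure_ext fun ψ => (hκ ψ).trans (isConv_conv lam lam' ψ).symm⟩

theorem isConv_invol_invol (lam lam' : RegularComplexMeasure (G ⧸ H)) :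
    IsConv (invol lam') (invol lam) (invol (conv lam lam')) := by
  intro ψ
  have hbound := norm_apply_le_norm ψ
  have hinv : Continuous fun z => starRingEnd ℂ (invKernel H ψ z) :=
    Complex.continuous_conj.comp (continuous_invKernel (map_continuous ψ))
  have hinvC : ∀ z, ‖starRingEnd ℂ (invKernel H ψ z)‖ ≤ ‖ψ‖ := fun z => by
    rw [RCLike.norm_conj]
    exact norm_invKernel_le hbound z
  have hleft : cintegral (invol (conv lam lam')).toComplexMeasure ψ =
      starRingEnd ℂ (cintegral lam'.toComplexMeasure fun y => cintegral lam.toComplexMeasure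
        fun x => convKernel H (fun z => starRingEnd ℂ (invKernel H ψ z)) x y) := by
    rw [isInvol_invol _ ψ, cintegral_conjMeasure _ fun i => integrable_of_continuous_of_bound _
      (continuous_invKernel (map_continuous ψ)) (norm_invKernel_le hbound)]
    exact congrArg (starRingEnd ℂ) (isConv_conv lam lam' (star (invKernelC0 ψ)))
  have hinner : ∀ y, cintegral (invol lam').toComplexMeasure (fun x => convKernel H ψ x y) =
      cintegral (conjRegular lam').toComplexMeasure fun x => invConvKernel ψ x y := fun y =>
    isInvol_invol lam' (convKernelC0 ψ y)
  have houter : ∀ x, cintegral (invol lam).toComplexMeasure (fun y => invConvKernel ψ x y) =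
      cintegral (conjRegular lam).toComplexMeasure fun y => starRingEnd ℂ
        (convKernel H (fun z => starRingEnd ℂ (invKernel H ψ z)) y x) := fun x => by
    refine (isInvol_invol lam (invConvKernelC0 ψ x)).trans ?_
    exact congrArg _ (funext fun y => invKernel_invConvKernel (map_continuous ψ) x y)
  simp only [hinner]
  rw [cintegral_swap (conjRegular lam') (invol lam) (continuous_invConvKernel (map_continuous ψ))
    (norm_invConvKernel_le hbound)]
  simp only [houter]
  rw [cintegral_conjRegular_conjRegular lam lam'
    (k := fun y x => starRingEnd ℂ (convKernel H (fun z => starRingEnd ℂ (invKernel H ψ z)) y x))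
    (Complex.continuous_conj.comp (continuous_convKernel hinv))
    (fun y x => (RCLike.norm_conj _).trans_le (norm_convKernel_le hinvC y x)), hleft]
  simp only [Complex.conj_conj]

end Existence

end ComplexCoset

end

/-- The first two conjuncts say that the convolution and the involution are well defined: their
defining equations on `C₀(G/H)` have exactly one solution in `M(G/H)`. -/
theorem mainTheorem2 {G : Type*} [Group G] [TopologicalSpace G] [IsTopologicalGroup G]
    [LocallyCompactSpace G] [T2Space G] [MeasurableSpace G] [BorelSpace G]
    (H : Subgroup G) [CompactSpace H]
    [MeasurableSpace (G ⧸ H)] [BorelSpace (G ⧸ H)]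
    (lam lam' : RegularComplexMeasure (G ⧸ H)) :
    (∃! κ, ComplexCoset.IsConv lam lam' κ) ∧
    (∃! κ, ComplexCoset.IsInvol lam κ) ∧
    ComplexCoset.invol (ComplexCoset.conv lam lam') =
      ComplexCoset.conv (ComplexCoset.invol lam') (ComplexCoset.invol lam) := by
  exact ⟨ComplexCoset.existsUnique_isConv lam lam', ComplexCoset.existsUnique_isInvol lam,
    (ComplexCoset.existsUnique_isConv _ _).unique (ComplexCoset.isConv_invol_invol lam lam')
      (ComplexCoset.isConv_conv _ _)⟩
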